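/- For real $y$ let $$\mathrm{Ai}_4(y)=\frac1\pi\int_0^\infty\cos\Big(\frac{t^5}{5}+yt\Big)\,dt,\qquad \widetilde{\mathrm{Ai}}_4(y)=\frac1\pi\int_0^\infty\Big[e^{-yt-t^5/5}-\sin\Big(\frac{t^5}{5}+yt\Big)\Big]dt,$$ the integrals being improper Riemann integrals, $\int_0^\infty=\lim_{R\to\infty}\int_0^R$. These integrals converge for every real $y$, and $\mathrm{Ai}_4$ and $\widetilde{\mathrm{Ai}}_4$ are three times continuously differentiable on $\mathbb R$. Put $$\Phi_1=\mathrm{Ai}_4\,\widetilde{\mathrm{Ai}}_4''-\mathrm{Ai}_4''\,\widetilde{\mathrm{Ai}}_4,\qquad \Phi_2=\mathrm{Ai}_4'\,\widetilde{\mathrm{Ai}}_4'''-\mathrm{Ai}_4'''\,\widetilde{\mathrm{Ai}}_4'.$$ Then there exists $0<\lambda_0\le 1/2$ such that for every $\lambda>\lambda_0$ $$\Phi_1(-\lambda)=\frac1\pi\lambda^{-1/4}e^{\frac45\lambda^{5/4}}\sin\Big(\frac45\lambda^{5/4}+\frac\pi4\Big)+O\Big(\frac{e^{\frac45\lambda^{5/4}}}{\lambda^{7/8}}\Big)$$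 and $$\Phi_2(-\lambda)=\frac1\pi\lambda^{1/4}e^{\frac45\lambda^{5/4}}\cos\Big(\frac45\lambda^{5/4}+\frac\pi4\Big)+O\Big(\frac{e^{\frac45\lambda^{5/4}}}{\lambda^{3/8}}\Big),$$ where the constants implied by the $O$-terms do not depend on $\lambda\in(\lambda_0,\infty)$. -/

import Mathlib

open Filter Topology

noncomputable section

/-- The improper integral `∫₀^∞ f(t) dt = lim_{R → ∞} ∫₀^R f(t) dt`. It is not required to converge
absolutely, so it is not the Lebesgue integral over `(0, ∞)`. -/
def improperIntegral (f : ℝ → ℝ) : ℝ :=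
  limUnder atTop (fun R : ℝ => ∫ t in (0 : ℝ)..R, f t)

/-- The integrand of the fourth-order Airy function. -/
def airyFourIntegrand (y t : ℝ) : ℝ :=
  Real.cos (t ^ 5 / 5 + y * t)

/-- The integrand of the second solution of the fourth-order Airy equation `φ'''' + y φ = 0`. -/
def airyFourTildeIntegrand (y t : ℝ) : ℝ :=
  Real.exp (-y * t - t ^ 5 / 5) - Real.sin (t ^ 5 / 5 + y * t)

/-- The fourth-order Airy function `Ai₄(y) = (1/π) ∫₀^∞ cos(t⁵/5 + y t) dt`. -/
def airyFour (y : ℝ) : ℝ :=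
  1 / Real.pi * improperIntegral (airyFourIntegrand y)

/-- The function `(1/π) ∫₀^∞ [exp(-y t - t⁵/5) - sin(t⁵/5 + y t)] dt`. -/
def airyFourTilde (y : ℝ) : ℝ :=
  1 / Real.pi * improperIntegral (airyFourTildeIntegrand y)

/-- `Φ₁ = Ai₄ · Ãi₄'' - Ai₄'' · Ãi₄`. -/
def Phi1 (y : ℝ) : ℝ :=
  airyFour y * iteratedDeriv 2 airyFourTilde y - iteratedDeriv 2 airyFour y * airyFourTilde y

/-- `Φ₂ = Ai₄' · Ãi₄''' - Ai₄''' · Ãi₄'`. -/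
def Phi2 (y : ℝ) : ℝ :=
  deriv airyFour y * iteratedDeriv 3 airyFourTilde y
    - iteratedDeriv 3 airyFour y * deriv airyFourTilde y

end

/-!
Both Airy functions are combinations of moments of `exp(i (t⁵/5 + y t))` and of the real integrals
`∫₀^∞ tᵏ exp(-t⁵/5 - y t) dt`. By Cauchy's theorem the half-line of the oscillatory integral may be
turned onto the ray `ℝ₊ (3 + i)`, where the integrand decays like `exp(-c s⁵)`
(`tendsto_integral_airyKernel`). There the improper integrals converge absolutely and may be
differentiated under the integral sign, and so all derivatives of both functions are given by the
moments `rotatedMoment` and `laplaceMoment` (`iteratedDeriv_airyFour`,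
`iteratedDeriv_airyFourTilde`).

At `y = -μ⁴` the substitution `t = μ s` turns the exponents into `i N (s⁵/5 - s)` and
`N (s - s⁵/5)` with `N = μ⁵`, both with a saddle point at `s = 1`. For the oscillatory moments the
path is deformed into a broken line through `1` in the steepest-descent direction `1 + i`
(`integral_saddleKernel_ray`). In both cases the integral near the saddle point is compared with a
Gaussian one (`norm_integral_sub_gaussian_le`), with an error `O(1/N)` against a main term of the
order `N^(-1/2)`; this crude error is all that the stated relations need. In `Phi1` and `Phi2`
each of the two products of an oscillating and an exponentially large moment contributes the same
main term (`exists_Phi_bounds`), and the products of two oscillating moments are negligible.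
The estimates hold for all `λ ≥ 1/2`, so `λ₀ = 1/2` will do.
-/

section

open MeasureTheory Set
open Complex (I)

/-! ### Moment integrals over the positive half-line -/

/-- The moment integral `∫₀^∞ sᵏ exp(-b s⁵ + a s) ds`. For `0 < b.re` it converges absolutely and is
an entire function of `a`. -/
noncomputable def rayIntegral (b a : ℂ) (k : ℕ) : ℂ :=
  ∫ s in Ioi (0 : ℝ), (s : ℂ) ^ k * Complex.exp (-b * s ^ 5 + a * s)

lemma exists_neg_quintic_add_linear_le {β : ℝ} (hβ : 0 < β) (α : ℝ) :
    ∃ M : ℝ, ∀ s : ℝ, 0 ≤ s → -β * s ^ 5 + α * s ≤ M - s := by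
  set A := |α| + 1 with hA
  have hA0 : 0 < A := by positivity
  -- For `s ≥ 1 + A/β` already `A s ≤ β s⁵`, because `s⁴ ≥ s ≥ A/β`.
  refine ⟨A * (1 + A / β), fun s hs => ?_⟩
  have h1 : α * s + s ≤ A * s := by nlinarith [le_abs_self α]
  rcases le_total s (1 + A / β) with h | h
  · have : A * s ≤ A * (1 + A / β) := by gcongr
    have : 0 ≤ β * s ^ 5 := by positivity
    linarith
  · have h0 : 0 < A / β := by positivity
    have hs1 : 1 ≤ s := by linarith
    have h4 : s ≤ s ^ 4 := le_self_pow₀ hs1 (by norm_num)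
    have h5 : A ≤ β * s ^ 4 := by
      have : A / β ≤ s ^ 4 := by linarith
      rwa [div_le_iff₀' hβ] at this
    have : A * s ≤ β * s ^ 5 := by
      calc A * s ≤ β * s ^ 4 * s := by gcongr
        _ = _ := by ring
    have : 0 ≤ A * (1 + A / β) := by positivity
    linarith

lemma integrableOn_pow_mul_exp_neg_mul (k : ℕ) {c : ℝ} (hc : 0 < c) :
    IntegrableOn (fun s : ℝ => s ^ k * Real.exp (-c * s)) (Ioi 0) := by
  have := integrableOn_rpow_mul_exp_neg_mul_rpow (s := k) (p := 1) (b := c)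
    (by have : (0 : ℝ) ≤ k := k.cast_nonneg
        linarith) one_pos hc
  simpa using this

lemma integrableOn_pow_mul_exp_quintic {β : ℝ} (hβ : 0 < β) (α : ℝ) (k : ℕ) :
    IntegrableOn (fun s : ℝ => s ^ k * Real.exp (-β * s ^ 5 + α * s)) (Ioi 0) := by
  obtain ⟨M, hM⟩ := exists_neg_quintic_add_linear_le hβ α
  refine ((integrableOn_pow_mul_exp_neg_mul k one_pos).const_mul (Real.exp M)).mono'
    (by fun_prop) ?_
  filter_upwards [ae_restrict_mem measurableSet_Ioi] with s hs
  have hs : 0 < s := hs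
  rw [Real.norm_of_nonneg (by positivity)]
  calc s ^ k * Real.exp (-β * s ^ 5 + α * s) ≤ s ^ k * Real.exp (M - s) := by
        gcongr; exact hM s hs.le
    _ = _ := by rw [sub_eq_add_neg, Real.exp_add]; ring_nf

lemma norm_rayIntegrand (b a : ℂ) (k : ℕ) {s : ℝ} (hs : 0 ≤ s) :
    ‖(s : ℂ) ^ k * Complex.exp (-b * s ^ 5 + a * s)‖
      = s ^ k * Real.exp (-b.re * s ^ 5 + a.re * s) := by
  rw [norm_mul, norm_pow, Complex.norm_real, Real.norm_of_nonneg hs, Complex.norm_exp]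
  congr 2
  simp only [Complex.add_re, ← Complex.ofReal_pow, Complex.re_mul_ofReal, Complex.neg_re]

lemma integrableOn_rayIntegrand {b : ℂ} (hb : 0 < b.re) (a : ℂ) (k : ℕ) :
    IntegrableOn (fun s : ℝ => (s : ℂ) ^ k * Complex.exp (-b * s ^ 5 + a * s)) (Ioi 0) := by
  refine (integrableOn_pow_mul_exp_quintic hb a.re k).mono' (by fun_prop) ?_
  filter_upwards [ae_restrict_mem measurableSet_Ioi] with s hs
  rw [norm_rayIntegrand b a k (le_of_lt hs)]

lemma hasDerivAt_rayIntegral {b : ℂ} (hb : 0 < b.re) (a : ℂ) (k : ℕ) :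
    HasDerivAt (fun z => rayIntegral b z k) (rayIntegral b a (k + 1)) a := by
  refine (hasDerivAt_integral_of_dominated_loc_of_deriv_le
    (F := fun z (s : ℝ) => (s : ℂ) ^ k * Complex.exp (-b * s ^ 5 + z * s))
    (F' := fun z (s : ℝ) => (s : ℂ) ^ (k + 1) * Complex.exp (-b * s ^ 5 + z * s))
    (bound := fun s => s ^ (k + 1) * Real.exp (-b.re * s ^ 5 + (a.re + 1) * s))
    (Metric.ball_mem_nhds a one_pos) (Eventually.of_forall fun z => by fun_prop)
    (integrableOn_rayIntegrand hb a k) (by fun_prop) ?_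
    (integrableOn_pow_mul_exp_quintic hb _ _) ?_).2
  · filter_upwards [ae_restrict_mem measurableSet_Ioi] with s hs z hz
    have hs : 0 < s := hs
    rw [norm_rayIntegrand b z _ hs.le]
    have : z.re ≤ a.re + 1 := by
      have h1 := (Complex.abs_re_le_norm (z - a)).trans (mem_ball_iff_norm.1 hz).le
      rw [Complex.sub_re] at h1
      linarith [(abs_le.1 h1).2]
    gcongr
  · refine Eventually.of_forall fun s z _ => ?_
    have h1 : HasDerivAt (fun z : ℂ => -b * (s : ℂ) ^ 5 + z * s) (s : ℂ) z := by
      simpa using ((hasDerivAt_id z).mul_const (s : ℂ)).const_add (-b * (s : ℂ) ^ 5)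
    convert! (h1.cexp).const_mul ((s : ℂ) ^ k) using 1
    ring

/-! ### Rotation of the contour -/

/-- The primitive of an entire function gives its integrals along all segments, so that the
integral along a broken line depends on the end points only. -/
lemma exists_integral_segment_eq_sub {f : ℂ → ℂ} (hf : Differentiable ℂ f) :
    ∃ P : ℂ → ℂ, ∀ (p v : ℂ) (x y : ℝ),
      ∫ s in x..y, v * f (p + s * v) = P (p + y * v) - P (p + x * v) := by
  obtain ⟨P, hP⟩ := hf.isExactOn_univ
  refine ⟨P, fun p v x y => ?_⟩
  refine intervalIntegral.integral_eq_sub_of_hasDerivAt (f := fun s : ℝ => P (p + s * v))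
    (fun s _ => ?_) ?_
  · have h1 : HasDerivAt (fun s : ℝ => p + s * v) v s := by
      simpa using ((Complex.ofRealCLM.hasDerivAt (x := s)).mul_const v).const_add p
    rw [mul_comm]
    exact (hP (p + s * v) (mem_univ _)).comp s h1
  · exact Continuous.intervalIntegrable (by have := hf.continuous; fun_prop) _ _

/-- The entire function `tᵏ exp(i (t⁵/5 + y t))`. -/
noncomputable def airyKernel (y : ℝ) (k : ℕ) (t : ℂ) : ℂ :=
  t ^ k * Complex.exp (I * (t ^ 5 / 5 + y * t))

lemma differentiable_airyKernel (y : ℝ) (k : ℕ) : Differentiable ℂ (airyKernel y k) := by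
  unfold airyKernel; fun_prop

/-- The integral of `tᵏ exp(i (t⁵/5 + y t))` along the ray `ℝ₊ (3 + i)`. This ray lies in the sector
`0 < arg t < π/5`, where the kernel decays; `3 + i` is chosen because it makes the fifth power
`-12 + 316 i` explicit and because the line through `1` in the direction `1 + i` meets the ray at
the point `(3 + i)/2`. -/
noncomputable def rotatedMoment (y : ℝ) (k : ℕ) : ℂ :=
  (3 + I) ^ (k + 1) * rayIntegral ((316 + 12 * I) / 5) (I * (3 + I) * y) k

lemma three_add_I_pow_five : (3 + I) ^ 5 = -12 + 316 * I := by
  have h2 : I ^ 2 = -1 := Complex.I_sq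
  linear_combination (I ^ 3 + 15 * I ^ 2 + 89 * I + 255) * h2

lemma airyKernel_ray (y : ℝ) (k : ℕ) (s : ℝ) :
    (3 + I) * airyKernel y k (s * (3 + I)) = (3 + I) ^ (k + 1) *
      ((s : ℂ) ^ k * Complex.exp (-((316 + 12 * I) / 5) * s ^ 5 + I * (3 + I) * y * s)) := by
  have : -((316 + 12 * I) / 5) * (s : ℂ) ^ 5 + I * (3 + I) * y * s
      = I * ((s : ℂ) ^ 5 * (-12 + 316 * I) / 5 + y * (s * (3 + I))) := by
    linear_combination (-316 / 5 * (s : ℂ) ^ 5) * Complex.I_sq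
  rw [airyKernel, mul_pow, mul_pow, three_add_I_pow_five, this]
  ring

lemma rotatedMoment_eq (y : ℝ) (k : ℕ) :
    rotatedMoment y k = ∫ s in Ioi (0 : ℝ), (3 + I) * airyKernel y k (s * (3 + I)) := by
  simp_rw [airyKernel_ray]
  rw [rotatedMoment, rayIntegral, ← integral_const_mul]

lemma integrableOn_airyKernel_ray (y : ℝ) (k : ℕ) :
    IntegrableOn (fun s : ℝ => (3 + I) * airyKernel y k (s * (3 + I))) (Ioi 0) := by
  simp_rw [airyKernel_ray]
  exact (integrableOn_rayIntegrand (by norm_num) _ k).const_mul _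

/-- On the vertical segment from `R` to the point `R + i R/3` of the ray `ℝ₊ (3 + i)` the kernel
decays fast enough for its integral to be `O(R⁻⁴)`. -/
lemma norm_airyKernel_vertical_le (y : ℝ) {R τ : ℝ} (hR : 1 ≤ R) (hy : |y| ≤ R / 4)
    (h0 : 0 ≤ τ) (h1 : τ ≤ R / 3) :
    ‖airyKernel y 0 (R + τ * I)‖ ≤ Real.exp (-(R ^ 4 / 2) * τ) := by
  rw [airyKernel, pow_zero, one_mul, Complex.norm_exp]
  gcongr
  have : (I * (((R : ℂ) + τ * I) ^ 5 / 5 + y * (R + τ * I))).re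
      = -(R ^ 4 * τ - 2 * R ^ 2 * τ ^ 3 + τ ^ 5 / 5 + y * τ) := by
    have h : ((R : ℂ) + τ * I) ^ 5 / 5 + y * (R + τ * I)
      = ((R ^ 5 / 5 - 2 * R ^ 3 * τ ^ 2 + R * τ ^ 4 + y * R : ℝ) : ℂ)
        + ((R ^ 4 * τ - 2 * R ^ 2 * τ ^ 3 + τ ^ 5 / 5 + y * τ : ℝ) : ℂ) * I := by
      push_cast
      linear_combination (2 * (R : ℂ) ^ 3 * τ ^ 2 + 2 * (R : ℂ) ^ 2 * τ ^ 3 * I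
        + R * τ ^ 4 * (I ^ 2 - 1) + τ ^ 5 / 5 * I * (I ^ 2 - 1)) * Complex.I_sq
    rw [h, Complex.I_mul_re, Complex.add_im, Complex.ofReal_im, Complex.im_ofReal_mul,
      Complex.I_im, zero_add, mul_one]
  rw [this]
  have hsq : τ ^ 2 ≤ R ^ 2 / 9 := by nlinarith
  have hR4 : R ≤ R ^ 4 := le_self_pow₀ hR (by norm_num)
  have h3 : R ^ 2 * τ ^ 2 ≤ R ^ 4 / 9 := by nlinarith [sq_nonneg R]
  have h5 : 0 ≤ τ ^ 5 := by positivity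
  have h6 : 0 ≤ τ * (R ^ 4 / 9 - R ^ 2 * τ ^ 2) := mul_nonneg h0 (by linarith)
  have h7 : 0 ≤ τ * (R ^ 4 / 4 + y) := mul_nonneg h0 (by linarith [neg_abs_le y])
  have h8 : 0 ≤ τ * R ^ 4 := by positivity
  nlinarith

lemma tendsto_integral_airyKernel_vertical (y : ℝ) :
    Tendsto (fun R : ℝ => ∫ τ in (0 : ℝ)..R / 3, I * airyKernel y 0 (R + τ * I)) atTop (𝓝 0) := by
  have hlim : Tendsto (fun R : ℝ => (R ^ 4 / 2)⁻¹) atTop (𝓝 0) :=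
    tendsto_inv_atTop_zero.comp
      ((tendsto_pow_atTop (by norm_num : (4 : ℕ) ≠ 0)).atTop_div_const two_pos)
  refine squeeze_zero_norm' ?_ hlim
  filter_upwards [eventually_ge_atTop (1 : ℝ), eventually_ge_atTop (4 * |y|)] with R hR hy
  have hR4 : 0 < R ^ 4 / 2 := by positivity
  have hR3 : 0 ≤ R / 3 := by positivity
  calc ‖∫ τ in (0 : ℝ)..R / 3, I * airyKernel y 0 (R + τ * I)‖
      ≤ ∫ τ in (0 : ℝ)..R / 3, Real.exp (-(R ^ 4 / 2) * τ) := by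
        refine intervalIntegral.norm_integral_le_of_norm_le hR3
          (Eventually.of_forall fun τ hτ => ?_) (Continuous.intervalIntegrable (by fun_prop) _ _)
        rw [norm_mul, Complex.norm_I, one_mul]
        exact norm_airyKernel_vertical_le y hR (by linarith) hτ.1.le hτ.2
    _ ≤ ∫ τ in Ioi (0 : ℝ), Real.exp (-(R ^ 4 / 2) * τ) := by
        rw [intervalIntegral.integral_of_le hR3]
        refine setIntegral_mono_set ?_ (Eventually.of_forall fun τ => (Real.exp_pos _).le)
          Ioc_subset_Ioi_self.eventuallyLE
        simpa using integrableOn_pow_mul_exp_neg_mul 0 hR4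
    _ = (R ^ 4 / 2)⁻¹ := by
        have := integral_exp_mul_Ioi (a := -(R ^ 4 / 2)) (by linarith) 0
        rw [this]
        simp

/-- Rotation of the contour: the improper integral along the positive real axis equals the
absolutely convergent one along the ray `ℝ₊ (3 + i)`. -/
lemma tendsto_integral_airyKernel (y : ℝ) :
    Tendsto (fun R : ℝ => ∫ t in (0 : ℝ)..R, airyKernel y 0 t) atTop (𝓝 (rotatedMoment y 0)) := by
  obtain ⟨P, hP⟩ := exists_integral_segment_eq_sub (differentiable_airyKernel y 0)
  have h1 : Tendsto (fun R : ℝ => ∫ s in (0 : ℝ)..R / 3, (3 + I) * airyKernel y 0 (s * (3 + I)))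
      atTop (𝓝 (rotatedMoment y 0)) := by
    rw [rotatedMoment_eq]
    exact intervalIntegral_tendsto_integral_Ioi 0 (integrableOn_airyKernel_ray y 0)
      (tendsto_id.atTop_div_const (by norm_num))
  have h2 := h1.sub (tendsto_integral_airyKernel_vertical y)
  rw [sub_zero] at h2
  refine h2.congr fun R => ?_
  -- The triangle with vertices `0`, `R` and `R + i R/3`.
  have e1 := hP 0 (3 + I) 0 (R / 3)
  have e2 := hP R I 0 (R / 3)
  have e3 := hP 0 1 0 R
  simp only [zero_add, one_mul, mul_one] at e1 e2 e3
  rw [e1, e2, e3]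
  have : ((R / 3 : ℝ) : ℂ) * (3 + I) = R + ((R / 3 : ℝ) : ℂ) * I := by push_cast; ring
  rw [this]
  simp

/-! ### Convergence and smoothness of the two Airy functions -/

/-- The moment `∫₀^∞ tᵏ exp(-t⁵/5 - y t) dt`, a real number regarded as a complex one. -/
noncomputable def laplaceMoment (y : ℝ) (k : ℕ) : ℂ := rayIntegral (1 / 5) (-y) k

lemma hasDerivAt_rotatedMoment (y : ℝ) (k : ℕ) :
    HasDerivAt (fun x : ℝ => rotatedMoment x k) (I * rotatedMoment y (k + 1)) y := by
  have h1 : HasDerivAt (fun x : ℝ => I * (3 + I) * (x : ℂ)) (I * (3 + I)) y := by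
    simpa using (Complex.ofRealCLM.hasDerivAt (x := y)).const_mul (I * (3 + I))
  have h2 := (hasDerivAt_rayIntegral (b := (316 + 12 * I) / 5) (by norm_num)
    (I * (3 + I) * y) k).comp y h1
  refine (h2.const_mul ((3 + I) ^ (k + 1))).congr_deriv ?_
  rw [rotatedMoment]
  ring

lemma hasDerivAt_laplaceMoment (y : ℝ) (k : ℕ) :
    HasDerivAt (fun x : ℝ => laplaceMoment x k) (-laplaceMoment y (k + 1)) y := by
  have h1 : HasDerivAt (fun x : ℝ => -(x : ℂ)) (-1) y := by
    simpa using (Complex.ofRealCLM.hasDerivAt (x := y)).fun_neg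
  have h2 := (hasDerivAt_rayIntegral (b := 1 / 5) (by norm_num) (-y) k).comp y h1
  refine h2.congr_deriv ?_
  rw [laplaceMoment]
  ring

lemma tendsto_integral_airyFourIntegrand (y : ℝ) :
    Tendsto (fun R : ℝ => ∫ t in (0 : ℝ)..R, airyFourIntegrand y t) atTop
      (𝓝 (rotatedMoment y 0).re) := by
  refine ((Complex.continuous_re.tendsto _).comp (tendsto_integral_airyKernel y)).congr fun R => ?_
  have hc := (differentiable_airyKernel y 0).continuous
  have h := Complex.reCLM.intervalIntegral_comp_comm
    (Continuous.intervalIntegrable (μ := volume) (u := fun t : ℝ => airyKernel y 0 t)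
      (by fun_prop) 0 R)
  simp only [Complex.reCLM_apply] at h
  rw [Function.comp_apply, ← h]
  congr 1 with t
  have : (t : ℂ) ^ 5 / 5 + y * t = ((t ^ 5 / 5 + y * t : ℝ) : ℂ) := by push_cast; ring
  rw [airyKernel, this, pow_zero, one_mul, mul_comm, Complex.exp_ofReal_mul_I_re,
    airyFourIntegrand]

lemma tendsto_integral_airyFourTildeIntegrand (y : ℝ) :
    Tendsto (fun R : ℝ => ∫ t in (0 : ℝ)..R, airyFourTildeIntegrand y t) atTop
      (𝓝 (laplaceMoment y 0 + I * rotatedMoment y 0).re) := by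
  have h0 := intervalIntegral_tendsto_integral_Ioi 0
    (integrableOn_rayIntegrand (b := 1 / 5) (by norm_num) (-y) 0) tendsto_id
  have h1 := h0.add ((tendsto_integral_airyKernel y).const_mul I)
  refine ((Complex.continuous_re.tendsto _).comp h1).congr fun R => ?_
  have hc := (differentiable_airyKernel y 0).continuous
  rw [Function.comp_apply, id_eq, ← intervalIntegral.integral_const_mul,
    ← intervalIntegral.integral_add (Continuous.intervalIntegrable (by fun_prop) _ _)
    (Continuous.intervalIntegrable (by fun_prop) _ _)]
  have h := Complex.reCLM.intervalIntegral_comp_comm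
    (Continuous.intervalIntegrable (μ := volume) (u := fun t : ℝ =>
      (t : ℂ) ^ 0 * Complex.exp (-(1 / 5) * t ^ 5 + -y * t) + I * airyKernel y 0 t)
      (by fun_prop) 0 R)
  simp only [Complex.reCLM_apply] at h
  rw [← h]
  congr 1 with t
  have e1 : (t : ℂ) ^ 5 / 5 + y * t = ((t ^ 5 / 5 + y * t : ℝ) : ℂ) := by push_cast; ring
  have e2 : -(1 / 5) * (t : ℂ) ^ 5 + -y * t = ((-y * t - t ^ 5 / 5 : ℝ) : ℂ) := by
    push_cast; ring
  rw [airyKernel, e1, e2, pow_zero, one_mul, one_mul, Complex.add_re, Complex.I_mul_re,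
    mul_comm I, Complex.exp_ofReal_mul_I_im, Complex.exp_ofReal_re, airyFourTildeIntegrand,
    ← sub_eq_add_neg]

lemma airyFour_eq : airyFour = fun y => 1 / Real.pi * (rotatedMoment y 0).re :=
  funext fun y => by
    rw [airyFour, improperIntegral, (tendsto_integral_airyFourIntegrand y).limUnder_eq]

lemma airyFourTilde_eq :
    airyFourTilde = fun y => 1 / Real.pi * (laplaceMoment y 0 + I * rotatedMoment y 0).re :=
  funext fun y => by
    rw [airyFourTilde, improperIntegral, (tendsto_integral_airyFourTildeIntegrand y).limUnder_eq]

lemma HasDerivAt.complex_re {f : ℝ → ℂ} {f' : ℂ} {x : ℝ} (h : HasDerivAt f f' x) :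
    HasDerivAt (fun y => (f y).re) f'.re x :=
  Complex.reCLM.hasFDerivAt.comp_hasDerivAt x h

lemma hasDerivAt_airyFour_formula (n : ℕ) (y : ℝ) :
    HasDerivAt (fun x : ℝ => 1 / Real.pi * (I ^ n * rotatedMoment x n).re)
      (1 / Real.pi * (I ^ (n + 1) * rotatedMoment y (n + 1)).re) y := by
  refine (((hasDerivAt_rotatedMoment y n).const_mul (I ^ n)).complex_re.const_mul _).congr_deriv ?_
  rw [pow_succ, mul_assoc]

lemma hasDerivAt_airyFourTilde_formula (n : ℕ) (y : ℝ) :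
    HasDerivAt (fun x : ℝ =>
        1 / Real.pi * ((-1) ^ n * laplaceMoment x n + I ^ (n + 1) * rotatedMoment x n).re)
      (1 / Real.pi * ((-1) ^ (n + 1) * laplaceMoment y (n + 1)
        + I ^ (n + 1 + 1) * rotatedMoment y (n + 1)).re) y := by
  refine ((((hasDerivAt_laplaceMoment y n).const_mul ((-1) ^ n)).add
    ((hasDerivAt_rotatedMoment y n).const_mul (I ^ (n + 1)))).complex_re.const_mul _).congr_deriv ?_
  congr 2
  ring

lemma iteratedDeriv_airyFour (n : ℕ) :
    iteratedDeriv n airyFour = fun y => 1 / Real.pi * (I ^ n * rotatedMoment y n).re := by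
  induction n with
  | zero => simp [airyFour_eq]
  | succ n ih =>
    rw [iteratedDeriv_succ, ih]
    exact funext fun y => (hasDerivAt_airyFour_formula n y).deriv

lemma iteratedDeriv_airyFourTilde (n : ℕ) :
    iteratedDeriv n airyFourTilde = fun y => 1 / Real.pi *
      ((-1) ^ n * laplaceMoment y n + I ^ (n + 1) * rotatedMoment y n).re := by
  induction n with
  | zero => simp [airyFourTilde_eq]
  | succ n ih =>
    rw [iteratedDeriv_succ, ih]
    exact funext fun y => (hasDerivAt_airyFourTilde_formula n y).deriv

lemma contDiff_airyFour : ContDiff ℝ 3 airyFour :=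
  contDiff_of_differentiable_iteratedDeriv (n := 3) fun m _ => by
    rw [iteratedDeriv_airyFour]
    exact fun y => (hasDerivAt_airyFour_formula m y).differentiableAt

lemma contDiff_airyFourTilde : ContDiff ℝ 3 airyFourTilde :=
  contDiff_of_differentiable_iteratedDeriv (n := 3) fun m _ => by
    rw [iteratedDeriv_airyFourTilde]
    exact fun y => (hasDerivAt_airyFourTilde_formula m y).differentiableAt

lemma Phi1_eq (y : ℝ) :
    Phi1 y = 1 / Real.pi ^ 2 *
      ((rotatedMoment y 0).re * ((laplaceMoment y 2).re + (rotatedMoment y 2).im)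
        + (rotatedMoment y 2).re * ((laplaceMoment y 0).re - (rotatedMoment y 0).im)) := by
  rw [Phi1, iteratedDeriv_airyFour, iteratedDeriv_airyFourTilde, airyFour_eq, airyFourTilde_eq]
  have h3 : I ^ (2 + 1) = -I := Complex.I_pow_three
  simp only [h3, Complex.I_sq, Complex.add_re, Complex.I_mul_re, neg_mul, one_mul, Complex.neg_re,
    neg_one_sq]
  ring

lemma Phi2_eq (y : ℝ) :
    Phi2 y = 1 / Real.pi ^ 2 *
      ((rotatedMoment y 1).im * ((laplaceMoment y 3).re - (rotatedMoment y 3).re)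
        + (rotatedMoment y 3).im * ((laplaceMoment y 1).re + (rotatedMoment y 1).re)) := by
  rw [Phi2, ← iteratedDeriv_one, ← iteratedDeriv_one, iteratedDeriv_airyFour,
    iteratedDeriv_airyFourTilde, iteratedDeriv_airyFour, iteratedDeriv_airyFourTilde]
  have h2 : I ^ (1 + 1) = -1 := Complex.I_sq
  have h4 : I ^ (3 + 1) = 1 := Complex.I_pow_four
  have h5 : (-1 : ℂ) ^ 3 = -1 := by norm_num
  simp only [h2, h4, h5, Complex.I_pow_three, pow_one, Complex.add_re, Complex.I_mul_re, neg_mul,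
    one_mul, Complex.neg_re]
  ring

/-! ### Laplace's method with a first-order remainder -/

lemma integrable_abs_pow_mul_gaussian (m : ℕ) {c : ℝ} (hc : 0 < c) :
    Integrable (fun u : ℝ => |u| ^ m * Real.exp (-c * u ^ 2)) := by
  have h := (integrable_rpow_mul_exp_neg_mul_sq hc (s := m)
    (by have : (0 : ℝ) ≤ m := m.cast_nonneg
        linarith)).norm
  refine h.congr (Eventually.of_forall fun u => ?_)
  simp

lemma integral_abs_odd_pow_mul_gaussian (m : ℕ) {c : ℝ} (hc : 0 < c) :
    ∫ u : ℝ, |u| ^ (2 * m + 1) * Real.exp (-c * u ^ 2) = m.factorial / c ^ (m + 1) := by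
  have h0 : (0 : ℝ) ≤ m := m.cast_nonneg
  have h := integral_rpow_mul_exp_neg_mul_rpow (p := 2) (q := ((2 * m + 1 : ℕ) : ℝ)) two_pos
    (by push_cast; linarith) hc
  have h2 := integral_comp_abs (f := fun u : ℝ => u ^ (2 * m + 1) * Real.exp (-c * u ^ 2))
  simp only [sq_abs] at h2
  simp only [Real.rpow_natCast, Real.rpow_two] at h
  rw [h2, h]
  have e1 : (((2 * m + 1 : ℕ) : ℝ) + 1) / 2 = m + 1 := by push_cast; ring
  rw [neg_div, e1, Real.Gamma_nat_eq_factorial, Real.rpow_neg hc.le]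
  norm_cast
  field_simp

/-- If `K` agrees with a Gaussian of width `N^(-1/2)` up to an odd-order relative error, then its
integral agrees with the Gaussian integral up to `O(1/N)`: in the integral of the error each factor
`|u|` counts for `N^(-1/2)`. -/
lemma norm_integral_sub_gaussian_le {K : ℝ → ℂ} {K₀ : ℂ} {α β C N : ℝ} (hα : 0 < α) (hβ : 0 < β)
    (hN : 0 < N) (hK : AEStronglyMeasurable K volume)
    (h : ∀ u : ℝ, ‖K u - K₀ * (Real.exp (-(N * α) * u ^ 2) : ℝ)‖
      ≤ C * (|u| + N * |u| ^ 3) * Real.exp (-(N * β) * u ^ 2)) :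
    ‖(∫ u, K u) - K₀ * (√(Real.pi / (N * α)) : ℝ)‖ ≤ C * (1 / β + 1 / β ^ 2) / N := by
  have hNβ : 0 < N * β := by positivity
  have i1 := integrable_abs_pow_mul_gaussian 1 hNβ
  have i3 := (integrable_abs_pow_mul_gaussian 3 hNβ).const_mul N
  have hB : (fun u : ℝ => C * (|u| + N * |u| ^ 3) * Real.exp (-(N * β) * u ^ 2)) = fun u : ℝ =>
      C * (|u| ^ 1 * Real.exp (-(N * β) * u ^ 2)
        + N * (|u| ^ 3 * Real.exp (-(N * β) * u ^ 2))) := by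
    ext u; ring
  have iB : Integrable fun u : ℝ => C * (|u| + N * |u| ^ 3) * Real.exp (-(N * β) * u ^ 2) := by
    rw [hB]
    exact (i1.add i3).const_mul C
  have ig : Integrable fun u : ℝ => K₀ * (Real.exp (-(N * α) * u ^ 2) : ℝ) :=
    ((integrable_exp_neg_mul_sq (by positivity)).ofReal).const_mul K₀
  have hd : Integrable fun u : ℝ => K u - K₀ * (Real.exp (-(N * α) * u ^ 2) : ℝ) :=
    iB.mono' (hK.sub ig.aestronglyMeasurable) (Eventually.of_forall h)
  have iK : Integrable K := (hd.add ig).congr (Eventually.of_forall fun u => by simp)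
  have e : (∫ u, K u) - K₀ * (√(Real.pi / (N * α)) : ℝ)
      = ∫ u, (K u - K₀ * (Real.exp (-(N * α) * u ^ 2) : ℝ)) := by
    rw [integral_sub iK ig, integral_const_mul, integral_complex_ofReal, integral_gaussian]
  rw [e]
  refine (norm_integral_le_of_norm_le iB (Eventually.of_forall h)).trans_eq ?_
  have e1 := integral_abs_odd_pow_mul_gaussian 0 hNβ
  have e3 := integral_abs_odd_pow_mul_gaussian 1 hNβ
  norm_num at e1 e3
  rw [hB, integral_const_mul, integral_add i1 i3, integral_const_mul]
  norm_num [e1, e3]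
  field_simp

lemma norm_cexp_sub_cexp_le {z w : ℂ} {M : ℝ} (hz : z.re ≤ M) (hw : w.re ≤ M) :
    ‖Complex.exp z - Complex.exp w‖ ≤ Real.exp M * ‖z - w‖ := by
  refine (convex_halfSpace_re_le M).norm_image_sub_le_of_norm_hasDerivWithin_le
    (f := Complex.exp) (f' := Complex.exp) (fun x _ => (Complex.hasDerivAt_exp x).hasDerivWithinAt)
    (fun x hx => ?_) hw hz
  rw [Complex.norm_exp]
  exact Real.exp_le_exp.2 hx

/-- The pointwise estimate for Laplace's method: a phase `h = α u² + O(|u|³)` and an amplitude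
`g = g₀ + O(|u|)` are replaced by their leading terms. -/
lemma norm_mul_cexp_sub_gaussian_le {g h g₀ : ℂ} {N α β D E u : ℝ} (hN : 0 ≤ N) (hD : 0 ≤ D)
    (hE : 0 ≤ E) (hαβ : β ≤ α) (hh : β * u ^ 2 ≤ h.re)
    (hd : ‖h - (α * u ^ 2 : ℝ)‖ ≤ D * |u| ^ 3) (hg : ‖g - g₀‖ ≤ E * |u|) :
    ‖g * Complex.exp (-(N * h)) - g₀ * (Real.exp (-(N * α) * u ^ 2) : ℝ)‖
      ≤ (E + ‖g₀‖ * D) * (|u| + N * |u| ^ 3) * Real.exp (-(N * β) * u ^ 2) := by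
  have hz : (-(N * h)).re ≤ -(N * β) * u ^ 2 := by
    rw [Complex.neg_re, Complex.re_ofReal_mul]
    nlinarith
  have hw : (((-(N * α) * u ^ 2 : ℝ) : ℂ)).re ≤ -(N * β) * u ^ 2 := by
    rw [Complex.ofReal_re]
    have : N * β * u ^ 2 ≤ N * α * u ^ 2 := by gcongr
    linarith
  have h1 : ‖Complex.exp (-(N * h))‖ ≤ Real.exp (-(N * β) * u ^ 2) := by
    rw [Complex.norm_exp]
    exact Real.exp_le_exp.2 hz
  have h2 : ‖Complex.exp (-(N * h)) - (Real.exp (-(N * α) * u ^ 2) : ℝ)‖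
      ≤ Real.exp (-(N * β) * u ^ 2) * (N * (D * |u| ^ 3)) := by
    rw [Complex.ofReal_exp]
    refine (norm_cexp_sub_cexp_le hz hw).trans ?_
    have : -((N : ℂ) * h) - ((-(N * α) * u ^ 2 : ℝ) : ℂ) = -(N * (h - (α * u ^ 2 : ℝ))) := by
      push_cast; ring
    rw [this, norm_neg, norm_mul, Complex.norm_real, Real.norm_of_nonneg hN]
    gcongr
  calc _ = ‖(g - g₀) * Complex.exp (-(N * h))
          + g₀ * (Complex.exp (-(N * h)) - (Real.exp (-(N * α) * u ^ 2) : ℝ))‖ := by ring_nf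
    _ ≤ (E * |u|) * Real.exp (-(N * β) * u ^ 2)
          + ‖g₀‖ * (Real.exp (-(N * β) * u ^ 2) * (N * (D * |u| ^ 3))) := by
        refine (norm_add_le _ _).trans ?_
        rw [norm_mul, norm_mul]
        gcongr
    _ ≤ _ := by
        have p1 : 0 ≤ E * (N * |u| ^ 3) * Real.exp (-(N * β) * u ^ 2) := by positivity
        have p2 : 0 ≤ ‖g₀‖ * D * |u| * Real.exp (-(N * β) * u ^ 2) := by positivity
        linarith

lemma norm_one_add_pow_sub_one_le (k : ℕ) {w : ℂ} (hw : ‖w‖ ≤ 2) :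
    ‖(1 + w) ^ k - 1‖ ≤ k * 3 ^ k * ‖w‖ := by
  have h1 : ‖1 + w‖ ≤ 3 := (norm_add_le _ _).trans (by norm_num; linarith)
  have h2 : (1 + w) ^ k - 1 = w * ∑ j ∈ Finset.range k, (1 + w) ^ j := by
    rw [← mul_geom_sum]; ring
  have h3 : ‖∑ j ∈ Finset.range k, (1 + w) ^ j‖ ≤ k * 3 ^ k := by
    calc _ ≤ ∑ _j ∈ Finset.range k, (3 : ℝ) ^ k := by
          refine norm_sum_le_of_le _ fun j hj => ?_
          rw [norm_pow]
          calc ‖1 + w‖ ^ j ≤ 3 ^ j := by gcongr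
            _ ≤ 3 ^ k := pow_le_pow_right₀ (by norm_num) (Finset.mem_range.1 hj).le
      _ = _ := by simp
  rw [h2, norm_mul, mul_comm]
  gcongr

/-! ### Stationary phase for the oscillatory moments -/

/-- The rescaled kernel `tᵏ exp(i N (t⁵/5 - t))`, whose phase has a saddle point at `t = 1`. -/
noncomputable def saddleKernel (N : ℝ) (k : ℕ) (t : ℂ) : ℂ :=
  t ^ k * Complex.exp (I * N * (t ^ 5 / 5 - t))

lemma differentiable_saddleKernel (N : ℝ) (k : ℕ) : Differentiable ℂ (saddleKernel N k) := by
  unfold saddleKernel; fun_prop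

/-- The substitution `t = μ s` moves the saddle point of `t⁵/5 - μ⁴ t` from `μ` to `1`. -/
lemma rotatedMoment_neg_pow_four (k : ℕ) {μ : ℝ} (hμ : 0 < μ) :
    rotatedMoment (-μ ^ 4) k = (μ : ℂ) ^ (k + 1) *
      ∫ s in Ioi (0 : ℝ), (3 + I) * saddleKernel (μ ^ 5) k (s * (3 + I)) := by
  have := integral_comp_mul_left_Ioi' (fun s : ℝ =>
    (3 + I) * airyKernel (-μ ^ 4) k (s * (3 + I))) 0 hμ
  rw [mul_zero] at this
  rw [rotatedMoment_eq, ← this, Complex.real_smul, ← integral_const_mul, ← integral_const_mul]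
  refine integral_congr_ae (Eventually.of_forall fun s => ?_)
  have e1 : ((μ * s : ℝ) : ℂ) * (3 + I) = μ * (s * (3 + I)) := by push_cast; ring
  have e2 (t : ℂ) : I * ((μ * t) ^ 5 / 5 + ((-μ ^ 4 : ℝ) : ℂ) * (μ * t))
      = I * ((μ ^ 5 : ℝ) : ℂ) * (t ^ 5 / 5 - t) := by push_cast; ring
  simp only [airyKernel, saddleKernel]
  rw [e1, e2, mul_pow]
  ring

lemma saddleKernel_ray (N : ℝ) (k : ℕ) (s : ℝ) :
    (3 + I) * saddleKernel N k (s * (3 + I)) = (3 + I) ^ (k + 1) * ((s : ℂ) ^ k *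
      Complex.exp (-((N : ℂ) * ((316 + 12 * I) / 5)) * s ^ 5 + N * (1 - 3 * I) * s)) := by
  have : -((N : ℂ) * ((316 + 12 * I) / 5)) * (s : ℂ) ^ 5 + N * (1 - 3 * I) * s
      = I * N * ((s : ℂ) ^ 5 * (-12 + 316 * I) / 5 - s * (3 + I)) := by
    linear_combination (-N * (316 / 5 * (s : ℂ) ^ 5 - s)) * Complex.I_sq
  rw [saddleKernel, mul_pow, mul_pow, three_add_I_pow_five, this]
  ring

lemma norm_saddleKernel_ray (N : ℝ) (k : ℕ) {s : ℝ} (hs : 0 ≤ s) :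
    ‖(3 + I) * saddleKernel N k (s * (3 + I))‖
      = ‖3 + I‖ ^ (k + 1) * (s ^ k * Real.exp (-(N * (316 / 5)) * s ^ 5 + N * s)) := by
  rw [saddleKernel_ray, norm_mul, norm_pow, norm_rayIntegrand _ _ _ hs]
  simp

lemma integrableOn_saddleKernel_ray {N : ℝ} (hN : 0 < N) (k : ℕ) :
    IntegrableOn (fun s : ℝ => (3 + I) * saddleKernel N k (s * (3 + I))) (Ioi 0) := by
  simp_rw [saddleKernel_ray]
  exact (integrableOn_rayIntegrand (by simpa using hN) _ k).const_mul _

/-- The path from `0` to infinity along the ray `ℝ₊ (3 + i)` is replaced by the broken line which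
runs from `0` to `-i`, then through the saddle point `1` in the direction `1 + i` to the point
`(3 + i)/2` of the ray, and then along the ray. -/
lemma integral_saddleKernel_ray {N : ℝ} (hN : 0 < N) (k : ℕ) :
    ∫ s in Ioi (0 : ℝ), (3 + I) * saddleKernel N k (s * (3 + I))
      = (∫ s in (0 : ℝ)..1, -I * saddleKernel N k (s * -I))
        + (∫ u in (-1 : ℝ)..1 / 2, (1 + I) * saddleKernel N k (1 + u * (1 + I)))
        + ∫ s in Ioi (1 / 2 : ℝ), (3 + I) * saddleKernel N k (s * (3 + I)) := by
  obtain ⟨P, hP⟩ := exists_integral_segment_eq_sub (differentiable_saddleKernel N k)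
  have hi := integrableOn_saddleKernel_ray hN k
  have e0 := intervalIntegral.integral_Ioi_sub_Ioi hi (by norm_num : (0 : ℝ) ≤ 1 / 2)
  have e1 := hP 0 (3 + I) 0 (1 / 2)
  have e2 := hP 0 (-I) 0 1
  have e3 := hP 1 (1 + I) (-1) (1 / 2)
  simp only [zero_add, Complex.ofReal_zero, zero_mul] at e1 e2
  rw [e2, e3]
  rw [e1] at e0
  have p1 : (0 : ℂ) + ((1 / 2 : ℝ) : ℂ) * (3 + I) = 1 + ((1 / 2 : ℝ) : ℂ) * (1 + I) := by
    push_cast; ring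
  have p2 : (1 : ℂ) + ((-1 : ℝ) : ℂ) * (1 + I) = ((1 : ℝ) : ℂ) * -I := by
    push_cast; ring
  rw [zero_add] at p1
  rw [p2, ← p1]
  linear_combination e0

lemma norm_integral_saddleKernel_imaginary_le {N : ℝ} (hN : 0 < N) (k : ℕ) :
    ‖∫ s in (0 : ℝ)..1, -I * saddleKernel N k (s * -I)‖ ≤ 5 / 4 / N := by
  have hc : 0 < 4 / 5 * N := by positivity
  calc _ ≤ ∫ s in (0 : ℝ)..1, Real.exp (-(4 / 5 * N) * s) := by
        refine intervalIntegral.norm_integral_le_of_norm_le zero_le_one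
          (Eventually.of_forall fun s hs => ?_) (Continuous.intervalIntegrable (by fun_prop) _ _)
        have h0 : 0 ≤ s := hs.1.le
        have e : I * N * (((s : ℂ) * -I) ^ 5 / 5 - s * -I) = ((N * (s ^ 5 / 5 - s) : ℝ) : ℂ) := by
          push_cast
          linear_combination (N * ((s : ℂ) - s ^ 5 / 5 * (I ^ 4 - I ^ 2 + 1))) * Complex.I_sq
        rw [saddleKernel, e, norm_mul, norm_mul, norm_pow, norm_mul, norm_neg, Complex.norm_I,
          Complex.norm_real, Real.norm_of_nonneg h0, one_mul, mul_one, Complex.norm_exp,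
          Complex.ofReal_re]
        have h5 : s ^ 5 ≤ s := pow_le_of_le_one h0 hs.2 (by norm_num)
        have h6 : N * (s ^ 5 / 5 - s) ≤ -(4 / 5 * N) * s := by nlinarith
        calc s ^ k * Real.exp (N * (s ^ 5 / 5 - s)) ≤ 1 * Real.exp (-(4 / 5 * N) * s) :=
              mul_le_mul (pow_le_one₀ h0 hs.2) (Real.exp_le_exp.2 h6) (Real.exp_pos _).le
                zero_le_one
          _ = _ := one_mul _
    _ ≤ ∫ s in Ioi (0 : ℝ), Real.exp (-(4 / 5 * N) * s) := by
        rw [intervalIntegral.integral_of_le zero_le_one]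
        refine setIntegral_mono_set ?_ (Eventually.of_forall fun τ => (Real.exp_pos _).le)
          Ioc_subset_Ioi_self.eventuallyLE
        simpa using integrableOn_pow_mul_exp_neg_mul 0 hc
    _ = 5 / 4 / N := by
        rw [integral_exp_mul_Ioi (a := -(4 / 5 * N)) (by linarith) 0]
        simp
        ring

lemma integral_pow_mul_exp_neg_mul (k : ℕ) {c : ℝ} (hc : 0 < c) :
    ∫ s in Ioi (0 : ℝ), s ^ k * Real.exp (-c * s) = k.factorial / c ^ (k + 1) := by
  have h0 : (0 : ℝ) ≤ k := k.cast_nonneg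
  have h := integral_rpow_mul_exp_neg_mul_rpow (p := 1) (q := k) one_pos (by linarith) hc
  simp only [Real.rpow_natCast, Real.rpow_one, div_one, Real.Gamma_nat_eq_factorial, mul_one] at h
  rw [h, Real.rpow_neg hc.le]
  norm_cast
  field_simp

lemma norm_integral_saddleKernel_tail_le {N : ℝ} (hN : 1 / 4 ≤ N) (k : ℕ) :
    ‖∫ s in Ioi (1 / 2 : ℝ), (3 + I) * saddleKernel N k (s * (3 + I))‖
      ≤ ‖3 + I‖ ^ (k + 1) * (k.factorial * 4 ^ k) / N := by
  have hN0 : 0 < N := by linarith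
  have hi := (integrableOn_pow_mul_exp_neg_mul k hN0).const_mul (‖3 + I‖ ^ (k + 1))
  calc _ ≤ ∫ s in Ioi (1 / 2 : ℝ), ‖3 + I‖ ^ (k + 1) * (s ^ k * Real.exp (-N * s)) := by
        refine norm_integral_le_of_norm_le
          (IntegrableOn.mono_set hi (Ioi_subset_Ioi (by norm_num))) ?_
        filter_upwards [ae_restrict_mem measurableSet_Ioi] with s hs
        have hs : 1 / 2 < s := hs
        have hs0 : 0 < s := by linarith
        rw [norm_saddleKernel_ray N k hs0.le]
        have h4 : (1 / 2) ^ 4 ≤ s ^ 4 := by gcongr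
        have h5 : 0 ≤ N * s * (s ^ 4 - (1 / 2) ^ 4) :=
          mul_nonneg (by positivity) (by linarith)
        have h6 : 0 ≤ N * s := by positivity
        gcongr
        nlinarith
    _ ≤ ∫ s in Ioi (0 : ℝ), ‖3 + I‖ ^ (k + 1) * (s ^ k * Real.exp (-N * s)) := by
        refine setIntegral_mono_set hi ?_ (Ioi_subset_Ioi (by norm_num)).eventuallyLE
        filter_upwards [ae_restrict_mem measurableSet_Ioi] with s hs
        have hs : 0 < s := hs
        simp only [Pi.zero_apply]
        positivity
    _ = ‖3 + I‖ ^ (k + 1) * (k.factorial / N ^ (k + 1)) := by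
        rw [integral_const_mul, integral_pow_mul_exp_neg_mul k hN0]
    _ ≤ _ := by
        rw [mul_div_assoc, pow_succ N, ← div_div]
        have : (k.factorial : ℝ) / N ^ k ≤ k.factorial * 4 ^ k := by
          rw [div_le_iff₀ (by positivity), mul_assoc, ← mul_pow]
          exact le_mul_of_one_le_right (by positivity) (one_le_pow₀ (by linarith))
        gcongr

/-- On the line `1 + u (1 + i)` through the saddle point, `i (t⁵/5 - t)` is `-4i/5` minus this
polynomial in `u`. -/
noncomputable def saddlePhase (u : ℝ) : ℂ :=
  4 * u ^ 2 + (4 + 4 * I) * u ^ 3 + 4 * I * u ^ 4 - (4 - 4 * I) / 5 * u ^ 5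

lemma saddleKernel_line (N : ℝ) (k : ℕ) (u : ℝ) :
    saddleKernel N k (1 + u * (1 + I)) = Complex.exp (-(4 / 5 * N * I)) *
      ((1 + u * (1 + I)) ^ k * Complex.exp (-(N * saddlePhase u))) := by
  have : I * N * ((1 + u * (1 + I)) ^ 5 / 5 - (1 + u * (1 + I)))
      = -(4 / 5 * N * I) + -(N * saddlePhase u) := by
    rw [saddlePhase]
    linear_combination (N * (u ^ 2 * (4 + 2 * I) + u ^ 3 * (4 + 4 * I + 2 * I * (1 + I))
      + u ^ 4 * I * (4 + 4 * I + (I ^ 2 + 1))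
      + u ^ 5 / 5 * (-4 + I * (1 + I) * (4 + 4 * I + (I ^ 2 + 1))))) * Complex.I_sq
  rw [saddleKernel, this, Complex.exp_add]
  ring

lemma saddlePhase_re (u : ℝ) : (saddlePhase u).re = 4 * u ^ 2 + 4 * u ^ 3 - 4 / 5 * u ^ 5 := by
  have : saddlePhase u = ((4 * u ^ 2 + 4 * u ^ 3 - 4 / 5 * u ^ 5 : ℝ) : ℂ)
      + ((4 * u ^ 3 + 4 * u ^ 4 + 4 / 5 * u ^ 5 : ℝ) : ℂ) * I := by
    rw [saddlePhase]; push_cast; ring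
  rw [this, Complex.add_re, Complex.ofReal_re, Complex.re_ofReal_mul, Complex.I_re, mul_zero,
    add_zero]

lemma le_saddlePhase_re {u : ℝ} (h1 : -1 ≤ u) (h2 : u ≤ 1 / 2) :
    4 / 5 * u ^ 2 ≤ (saddlePhase u).re := by
  rw [saddlePhase_re]
  have : 0 ≤ 4 + 4 * u - 4 / 5 * u ^ 3 - 4 / 5 := by
    nlinarith [mul_nonneg (by linarith : 0 ≤ u + 1) (by linarith : 0 ≤ 1 / 2 - u),
      mul_nonneg (mul_nonneg (by linarith : 0 ≤ u + 1) (by linarith : 0 ≤ u + 1))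
        (by linarith : 0 ≤ 1 / 2 - u)]
  nlinarith [mul_nonneg (sq_nonneg u) this]

lemma norm_saddlePhase_sub_le {u : ℝ} (hu : |u| ≤ 1) :
    ‖saddlePhase u - (4 * u ^ 2 : ℝ)‖ ≤ 16 * |u| ^ 3 := by
  have e : saddlePhase u - (4 * u ^ 2 : ℝ)
      = (4 + 4 * I + 4 * I * u - (4 - 4 * I) / 5 * u ^ 2) * (u : ℂ) ^ 3 := by
    rw [saddlePhase]; push_cast; ring
  have hI : ‖I‖ = 1 := Complex.norm_I
  have hu' : ‖(u : ℂ)‖ ≤ 1 := by rwa [Complex.norm_real]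
  have n1 : ‖(4 : ℂ) + 4 * I‖ ≤ 8 := (norm_add_le _ _).trans (by norm_num)
  have n2 : ‖4 * I * (u : ℂ)‖ ≤ 4 := by
    rw [norm_mul, norm_mul, hI]; norm_num at hu' ⊢; linarith
  have n3 : ‖(4 : ℂ) - 4 * I‖ ≤ 8 := (norm_sub_le _ _).trans (by norm_num)
  have n4 : ‖(4 - 4 * I) / 5 * (u : ℂ) ^ 2‖ ≤ 2 := by
    rw [norm_mul, norm_div, norm_pow]
    have : ‖(u : ℂ)‖ ^ 2 ≤ 1 := pow_le_one₀ (norm_nonneg _) hu'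
    have h5 : ‖(5 : ℂ)‖ = 5 := by norm_num
    rw [h5]
    calc _ ≤ 8 / 5 * 1 := by gcongr
      _ ≤ (2 : ℝ) := by norm_num
  rw [e, norm_mul, norm_pow, Complex.norm_real, Real.norm_eq_abs]
  gcongr
  calc _ ≤ ‖4 + 4 * I + 4 * I * (u : ℂ)‖ + ‖(4 - 4 * I) / 5 * (u : ℂ) ^ 2‖ := norm_sub_le _ _
    _ ≤ ‖4 + 4 * I‖ + ‖4 * I * (u : ℂ)‖ + ‖(4 - 4 * I) / 5 * (u : ℂ) ^ 2‖ := by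
        gcongr; exact norm_add_le _ _
    _ ≤ 16 := by linarith

lemma norm_one_add_I_le : ‖1 + I‖ ≤ 2 := (norm_add_le _ _).trans (by norm_num)

/-- At a distance `δ` from the saddle point the Gaussian itself is an error term. -/
lemma norm_gaussian_le_of_le_abs {g₀ : ℂ} {N α β C δ u : ℝ} (hN : 0 ≤ N) (hαβ : β ≤ α)
    (hδ : 0 < δ) (hu : δ ≤ |u|) (hC : ‖g₀‖ / δ ≤ C) :
    ‖g₀ * (Real.exp (-(N * α) * u ^ 2) : ℝ)‖
      ≤ C * (|u| + N * |u| ^ 3) * Real.exp (-(N * β) * u ^ 2) := by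
  have h0 : ‖g₀‖ ≤ C * |u| := by
    rw [div_le_iff₀ hδ] at hC
    have : 0 ≤ C := by
      by_contra h
      nlinarith [norm_nonneg g₀]
    exact hC.trans (by gcongr)
  have h1 : 0 ≤ C := by
    refine le_trans ?_ hC
    positivity
  rw [norm_mul, Complex.norm_real, Real.norm_of_nonneg (Real.exp_pos _).le]
  gcongr
  refine h0.trans ?_
  gcongr
  have : 0 ≤ N * |u| ^ 3 := by positivity
  linarith

lemma exists_norm_integral_saddleKernel_line_le (k : ℕ) : ∃ C : ℝ, ∀ N : ℝ, 0 < N →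
    ‖(∫ u in (-1 : ℝ)..1 / 2, (1 + I) * saddleKernel N k (1 + u * (1 + I)))
      - Complex.exp (-(4 / 5 * N * I)) * ((1 + I) * (√(Real.pi / (N * 4)) : ℝ))‖ ≤ C / N := by
  set C := 2 * (2 * (k * 3 ^ k)) + ‖1 + I‖ * 16 + ‖1 + I‖ / (1 / 2) with hC
  refine ⟨C * (1 / (4 / 5) + 1 / (4 / 5) ^ 2), fun N hN => ?_⟩
  set K : ℝ → ℂ := (Ioc (-1) (1 / 2)).indicator fun u =>
    ((1 + I) * (1 + u * (1 + I)) ^ k) * Complex.exp (-(N * saddlePhase u)) with hK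
  have e : ∫ u in (-1 : ℝ)..1 / 2, (1 + I) * saddleKernel N k (1 + u * (1 + I))
      = Complex.exp (-(4 / 5 * N * I)) * ∫ u, K u := by
    rw [hK, integral_indicator measurableSet_Ioc, ← integral_const_mul,
      intervalIntegral.integral_of_le (by norm_num)]
    congr 1 with u
    rw [saddleKernel_line]
    ring
  have hexp : ‖Complex.exp (-(4 / 5 * N * I))‖ = 1 := by
    have : -(4 / 5 * (N : ℂ) * I) = ((-(4 / 5 * N) : ℝ) : ℂ) * I := by push_cast; ring
    rw [this, Complex.norm_exp_ofReal_mul_I]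
  rw [e, ← mul_sub, norm_mul, hexp, one_mul]
  refine norm_integral_sub_gaussian_le (by norm_num) (by norm_num) hN ?_ fun u => ?_
  · refine AEStronglyMeasurable.indicator (Continuous.aestronglyMeasurable ?_) measurableSet_Ioc
    unfold saddlePhase
    fun_prop
  by_cases hu : u ∈ Ioc (-1 : ℝ) (1 / 2)
  · have hu1 : |u| ≤ 1 := abs_le.2 ⟨hu.1.le, by linarith [hu.2]⟩
    rw [hK, indicator_of_mem hu]
    refine (norm_mul_cexp_sub_gaussian_le (D := 16) (E := 2 * (2 * (k * 3 ^ k))) hN.le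
      (by norm_num) (by positivity) (by norm_num)
      (le_saddlePhase_re hu.1.le hu.2) (norm_saddlePhase_sub_le hu1) ?_).trans ?_
    · have hw : ‖(u : ℂ) * (1 + I)‖ ≤ 2 * |u| := by
        rw [norm_mul, Complex.norm_real, Real.norm_eq_abs, mul_comm]
        gcongr
        exact norm_one_add_I_le
      have h1 := norm_one_add_pow_sub_one_le k (w := u * (1 + I)) (by linarith)
      have h2 : (1 + I) * (1 + u * (1 + I)) ^ k - (1 + I)
          = (1 + I) * ((1 + u * (1 + I)) ^ k - 1) := by ring
      rw [h2, norm_mul]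
      calc _ ≤ 2 * (k * 3 ^ k * (2 * |u|)) := by
            gcongr
            · exact norm_one_add_I_le
            · exact h1.trans (by gcongr)
        _ = _ := by ring
    · gcongr
      rw [hC]
      exact le_add_of_nonneg_right (by positivity)
  · rw [hK, indicator_of_notMem hu, zero_sub, norm_neg]
    refine norm_gaussian_le_of_le_abs (δ := 1 / 2) hN.le (by norm_num) (by norm_num) ?_ ?_
    · by_contra! h
      rw [abs_lt] at h
      exact hu ⟨by linarith, h.2.le⟩
    · rw [hC]
      exact le_add_of_nonneg_left (by positivity)

/-- Stationary phase: the saddle point contributes the main term, and the two other parts of the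
broken line are `O(1/N)`. -/
lemma exists_norm_integral_saddleKernel_ray_sub_le (k : ℕ) : ∃ C : ℝ, ∀ N : ℝ, 1 / 4 ≤ N →
    ‖(∫ s in Ioi (0 : ℝ), (3 + I) * saddleKernel N k (s * (3 + I)))
      - Complex.exp (-(4 / 5 * N * I)) * ((1 + I) * (√(Real.pi / (N * 4)) : ℝ))‖ ≤ C / N := by
  obtain ⟨C, hC⟩ := exists_norm_integral_saddleKernel_line_le k
  refine ⟨5 / 4 + C + ‖3 + I‖ ^ (k + 1) * (k.factorial * 4 ^ k), fun N hN => ?_⟩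
  have hN0 : 0 < N := by linarith
  have h1 := norm_integral_saddleKernel_imaginary_le hN0 k
  have h2 := hC N hN0
  have h3 := norm_integral_saddleKernel_tail_le hN k
  rw [integral_saddleKernel_ray hN0, add_div, add_div]
  set A := ∫ s in (0 : ℝ)..1, -I * saddleKernel N k (s * -I)
  set B := ∫ u in (-1 : ℝ)..1 / 2, (1 + I) * saddleKernel N k (1 + u * (1 + I))
  set D := ∫ s in Ioi (1 / 2 : ℝ), (3 + I) * saddleKernel N k (s * (3 + I))
  set G := Complex.exp (-(4 / 5 * N * I)) * ((1 + I) * (√(Real.pi / (N * 4)) : ℝ))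
  calc ‖A + B + D - G‖ = ‖A + (B - G) + D‖ := by ring_nf
    _ ≤ ‖A‖ + ‖B - G‖ + ‖D‖ := norm_add₃_le
    _ ≤ _ := by linarith

/-! ### Laplace's method for the exponentially large moments -/

lemma laplaceMoment_neg_pow_four (k : ℕ) {μ : ℝ} (hμ : 0 < μ) :
    laplaceMoment (-μ ^ 4) k = (μ : ℂ) ^ (k + 1) *
      ∫ s in Ioi (0 : ℝ), (s : ℂ) ^ k * Complex.exp ((μ ^ 5 * (s - s ^ 5 / 5) : ℝ)) := by
  have := integral_comp_mul_left_Ioi' (fun s : ℝ =>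
    (s : ℂ) ^ k * Complex.exp (-(1 / 5) * s ^ 5 + -((-μ ^ 4 : ℝ) : ℂ) * s)) 0 hμ
  rw [mul_zero] at this
  rw [laplaceMoment, rayIntegral, ← this, Complex.real_smul, ← integral_const_mul,
    ← integral_const_mul]
  refine integral_congr_ae (Eventually.of_forall fun s => ?_)
  have e : -(1 / 5) * ((μ * s : ℝ) : ℂ) ^ 5 + -((-μ ^ 4 : ℝ) : ℂ) * ((μ * s : ℝ) : ℂ)
      = (μ ^ 5 * (s - s ^ 5 / 5) : ℝ) := by push_cast; ring
  simp only [e]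
  push_cast
  rw [mul_pow]
  ring

/-- At `s = 1 + u` the exponent `s - s⁵/5` is `4/5` minus this polynomial in `u`. -/
noncomputable def laplacePhase (u : ℝ) : ℝ := 2 * u ^ 2 + 2 * u ^ 3 + u ^ 4 + u ^ 5 / 5

lemma le_laplacePhase {u : ℝ} (h1 : -1 ≤ u) : 4 / 5 * u ^ 2 ≤ laplacePhase u := by
  have h3 : 0 ≤ 2 + 2 * u + u ^ 2 + u ^ 3 / 5 - 4 / 5 := by
    have e : 2 + 2 * u + u ^ 2 + u ^ 3 / 5 - 4 / 5
        = (1 + u) * (3 / 5 + 2 / 5 * (1 + u) + (1 + u) ^ 2 / 5) := by ring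
    rw [e]
    have : 0 ≤ 1 + u := by linarith
    positivity
  rw [laplacePhase]
  nlinarith [mul_nonneg (sq_nonneg u) h3]

lemma abs_laplacePhase_sub_le {u : ℝ} (hu : |u| ≤ 1) :
    |laplacePhase u - 2 * u ^ 2| ≤ 4 * |u| ^ 3 := by
  have e : laplacePhase u - 2 * u ^ 2 = (2 + u + u ^ 2 / 5) * u ^ 3 := by
    rw [laplacePhase]; ring
  rw [e, abs_mul, abs_pow]
  gcongr
  rw [abs_le] at hu ⊢
  constructor <;> nlinarith

/-- To the right of `u = 1` the integrand itself is an error term: half of the exponent absorbs the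
growth of the amplitude. -/
lemma pow_mul_exp_neg_laplacePhase_le (k : ℕ) {N u : ℝ} (hN : 1 / 4 ≤ N) (hu : 1 ≤ u) :
    (1 + u) ^ k * Real.exp (-(N * laplacePhase u))
      ≤ 8 ^ k * k.factorial * (|u| + N * |u| ^ 3) * Real.exp (-(N * (4 / 5)) * u ^ 2) := by
  have hu0 : 0 ≤ u := by linarith
  have hN0 : 0 < N := by linarith
  have h1 : u ^ k ≤ 4 ^ k * k.factorial * Real.exp (N * u ^ 2) := by
    have h := Real.pow_div_factorial_le_exp (u ^ 2 / 4) (by positivity) k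
    rw [div_le_iff₀ (by positivity), div_pow, div_le_iff₀ (by positivity)] at h
    calc u ^ k ≤ (u ^ 2) ^ k := by gcongr; nlinarith
      _ ≤ Real.exp (u ^ 2 / 4) * k.factorial * 4 ^ k := h
      _ ≤ Real.exp (N * u ^ 2) * k.factorial * 4 ^ k := by gcongr; nlinarith [sq_nonneg u]
      _ = _ := by ring
  have h2 : (1 + u) ^ k ≤ 8 ^ k * k.factorial * Real.exp (N * u ^ 2) := by
    calc (1 + u) ^ k ≤ (2 * u) ^ k := by gcongr; linarith
      _ = 2 ^ k * u ^ k := mul_pow _ _ _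
      _ ≤ 2 ^ k * (4 ^ k * k.factorial * Real.exp (N * u ^ 2)) := by gcongr
      _ = 8 ^ k * k.factorial * Real.exp (N * u ^ 2) := by
        rw [show (8 : ℝ) = 2 * 4 by norm_num, mul_pow]; ring
  have h3 : 2 * u ^ 2 ≤ laplacePhase u := by
    have : 0 ≤ 2 * u ^ 3 + u ^ 4 + u ^ 5 / 5 := by positivity
    rw [laplacePhase]
    linarith
  have h4 : N * u ^ 2 + -(N * laplacePhase u) ≤ -(N * (4 / 5)) * u ^ 2 := by
    nlinarith [mul_le_mul_of_nonneg_left h3 hN0.le, mul_nonneg hN0.le (sq_nonneg u)]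
  have h5 : 1 ≤ |u| + N * |u| ^ 3 := by
    have : 0 ≤ N * |u| ^ 3 := by positivity
    linarith [le_abs_self u]
  calc _ ≤ 8 ^ k * k.factorial * Real.exp (N * u ^ 2) * Real.exp (-(N * laplacePhase u)) := by
        gcongr
    _ = 8 ^ k * k.factorial * 1 * Real.exp (N * u ^ 2 + -(N * laplacePhase u)) := by
        rw [Real.exp_add]; ring
    _ ≤ _ := by gcongr

lemma integral_laplace_shift (N : ℝ) (k : ℕ) :
    ∫ s in Ioi (0 : ℝ), (s : ℂ) ^ k * Complex.exp ((N * (s - s ^ 5 / 5) : ℝ))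
      = (Real.exp (4 / 5 * N) : ℝ) * ∫ u, (Ioi (-1 : ℝ)).indicator
          (fun u : ℝ => (1 + (u : ℂ)) ^ k * Complex.exp (-(N * (laplacePhase u : ℝ)))) u := by
  rw [← integral_indicator measurableSet_Ioi, ← integral_add_left_eq_self _ (1 : ℝ),
    ← integral_const_mul]
  congr 1 with u
  by_cases hu : -1 < u
  · rw [indicator_of_mem (by simpa using by linarith), indicator_of_mem (by simpa using hu),
      Complex.ofReal_exp]
    have : ((N * ((1 + u) - (1 + u) ^ 5 / 5) : ℝ) : ℂ)
        = ((4 / 5 * N : ℝ) : ℂ) + -(N * (laplacePhase u : ℝ)) := by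
      rw [laplacePhase]; push_cast; ring
    rw [this, Complex.exp_add]
    push_cast
    ring
  · rw [indicator_of_notMem (by simpa using by linarith), indicator_of_notMem (by simpa using hu),
      mul_zero]

lemma exists_norm_integral_laplace_sub_le (k : ℕ) : ∃ C : ℝ, ∀ N : ℝ, 1 / 4 ≤ N →
    ‖(∫ s in Ioi (0 : ℝ), (s : ℂ) ^ k * Complex.exp ((N * (s - s ^ 5 / 5) : ℝ)))
      - (Real.exp (4 / 5 * N) * √(Real.pi / (N * 2)) : ℝ)‖ ≤ C * Real.exp (4 / 5 * N) / N := by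
  set C : ℝ := (k * 3 ^ k + ‖(1 : ℂ)‖ * 4) + 8 ^ k * k.factorial + ‖(1 : ℂ)‖ / 1 with hC
  refine ⟨C * (1 / (4 / 5) + 1 / (4 / 5) ^ 2), fun N hN => ?_⟩
  have hN0 : 0 < N := by linarith
  set K : ℝ → ℂ := (Ioi (-1 : ℝ)).indicator
    (fun u : ℝ => (1 + (u : ℂ)) ^ k * Complex.exp (-(N * (laplacePhase u : ℝ)))) with hK
  have key : ‖(∫ u, K u) - 1 * (√(Real.pi / (N * 2)) : ℝ)‖
      ≤ C * (1 / (4 / 5) + 1 / (4 / 5) ^ 2) / N := by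
    refine norm_integral_sub_gaussian_le (by norm_num) (by norm_num) hN0 ?_ fun u => ?_
    · refine AEStronglyMeasurable.indicator (Continuous.aestronglyMeasurable ?_) measurableSet_Ioi
      unfold laplacePhase
      fun_prop
    have hpos : 0 ≤ (|u| + N * |u| ^ 3) * Real.exp (-(N * (4 / 5)) * u ^ 2) := by positivity
    by_cases hu : -1 < u
    · rw [hK, indicator_of_mem (by simpa using hu)]
      rcases le_total u 1 with hu1 | hu1
      · have hu' : |u| ≤ 1 := abs_le.2 ⟨hu.le, hu1⟩
        refine (norm_mul_cexp_sub_gaussian_le (α := 2) (β := 4 / 5) (D := 4) (E := k * 3 ^ k) hN0.le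
          (by norm_num) (by positivity) (by norm_num)
          (by rw [Complex.ofReal_re]; exact le_laplacePhase hu.le) ?_ ?_).trans ?_
        · rw [← Complex.ofReal_sub, Complex.norm_real]
          exact abs_laplacePhase_sub_le hu'
        · have hw : ‖(u : ℂ)‖ = |u| := by rw [Complex.norm_real, Real.norm_eq_abs]
          have h1 := norm_one_add_pow_sub_one_le k (w := (u : ℂ)) (by rw [hw]; linarith)
          rwa [hw] at h1
        · gcongr
          rw [hC, add_assoc]
          exact le_add_of_nonneg_right (by positivity)
      · have h1 := pow_mul_exp_neg_laplacePhase_le k hN hu1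
        have h2 := norm_gaussian_le_of_le_abs (g₀ := 1) (N := N) (α := 2) (β := 4 / 5)
          (C := ‖(1 : ℂ)‖ / 1) hN0.le (by norm_num) one_pos (hu1.trans (le_abs_self u)) le_rfl
        have h3 : ‖(1 + (u : ℂ)) ^ k * Complex.exp (-(N * (laplacePhase u : ℝ)))‖
            = (1 + u) ^ k * Real.exp (-(N * laplacePhase u)) := by
          have e1 : (1 + (u : ℂ)) = ((1 + u : ℝ) : ℂ) := by push_cast; ring
          have e2 : -((N : ℂ) * (laplacePhase u : ℝ)) = ((-(N * laplacePhase u) : ℝ) : ℂ) := by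
            push_cast; ring
          rw [e1, e2, norm_mul, norm_pow, Complex.norm_real, Real.norm_of_nonneg (by linarith),
            Complex.norm_exp, Complex.ofReal_re]
        refine (norm_sub_le _ _).trans ((add_le_add (h3.trans_le h1) h2).trans ?_)
        have h4 : 0 ≤ (k * 3 ^ k + ‖(1 : ℂ)‖ * 4)
            * ((|u| + N * |u| ^ 3) * Real.exp (-(N * (4 / 5)) * u ^ 2)) :=
          mul_nonneg (by positivity) hpos
        rw [hC]
        linarith
    · rw [hK, indicator_of_notMem (by simpa using hu), zero_sub, norm_neg]
      refine norm_gaussian_le_of_le_abs (δ := 1) hN0.le (by norm_num) one_pos ?_ ?_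
      · rw [abs_of_nonpos (by linarith)]
        linarith
      · rw [hC]
        exact le_add_of_nonneg_left (by positivity)
  rw [integral_laplace_shift, Complex.ofReal_mul, ← mul_sub, norm_mul, Complex.norm_real,
    Real.norm_of_nonneg (Real.exp_pos _).le]
  rw [one_mul] at key
  calc _ ≤ Real.exp (4 / 5 * N) * (C * (1 / (4 / 5) + 1 / (4 / 5) ^ 2) / N) := by gcongr
    _ = _ := by ring

/-! ### Asymptotics of the Wronskian-type expressions -/

/-- After removal of the factor `μ^(k+1)`, the leading terms of the moments do not depend on `k`;
the leading term of the oscillatory one is `σ e^{-iz} e^{iπ/4} = σ (sin(z + π/4) + i cos(z + π/4))`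
with `z = 4 μ⁵/5`. -/
lemma exists_moment_asymptotics : ∃ C : ℝ, 0 ≤ C ∧ ∀ k < 4, ∀ μ : ℝ, 0 < μ → 1 / 4 ≤ μ ^ 5 →
    ∃ (X : ℂ) (Y : ℝ), rotatedMoment (-μ ^ 4) k = (μ ^ (k + 1) : ℝ) * X ∧
      (laplaceMoment (-μ ^ 4) k).re = μ ^ (k + 1) * Y ∧
      |X.re - √(Real.pi / (μ ^ 5 * 2)) * Real.sin (4 / 5 * μ ^ 5 + Real.pi / 4)| ≤ C / μ ^ 5 ∧
      |X.im - √(Real.pi / (μ ^ 5 * 2)) * Real.cos (4 / 5 * μ ^ 5 + Real.pi / 4)| ≤ C / μ ^ 5 ∧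
      |Y - √(Real.pi / (μ ^ 5 * 2)) * Real.exp (4 / 5 * μ ^ 5)|
        ≤ C * Real.exp (4 / 5 * μ ^ 5) / μ ^ 5 := by
  choose A hA using exists_norm_integral_saddleKernel_ray_sub_le
  choose B hB using exists_norm_integral_laplace_sub_le
  have hs0 : ∀ j ∈ Finset.range 4, 0 ≤ |A j| + |B j| := fun j _ => by positivity
  refine ⟨∑ j ∈ Finset.range 4, (|A j| + |B j|), Finset.sum_nonneg hs0, fun k hk μ hμ hN => ?_⟩
  set C := ∑ j ∈ Finset.range 4, (|A j| + |B j|)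
  have hkC : |A k| + |B k| ≤ C :=
    Finset.single_le_sum (f := fun j => |A j| + |B j|) hs0 (Finset.mem_range.2 hk)
  have hAC : A k ≤ C := by linarith [le_abs_self (A k), abs_nonneg (B k)]
  have hBC : B k ≤ C := by linarith [le_abs_self (B k), abs_nonneg (A k)]
  have hX := hA k _ hN
  have hY := hB k _ hN
  have eX := rotatedMoment_neg_pow_four k hμ
  have eY := laplaceMoment_neg_pow_four k hμ
  set N := μ ^ 5 with hNdef
  have hN0 : 0 < N := by positivity
  set X := ∫ s in Ioi (0 : ℝ), (3 + I) * saddleKernel N k (s * (3 + I))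
  set Y := ∫ s in Ioi (0 : ℝ), (s : ℂ) ^ k * Complex.exp ((N * (s - s ^ 5 / 5) : ℝ))
  set z := 4 / 5 * N with hz
  have hσ : √(Real.pi / (N * 2)) = √2 * √(Real.pi / (N * 4)) := by
    rw [← Real.sqrt_mul (by norm_num)]
    congr 1
    field_simp
    norm_num
  have h2 : √2 * (√2 / 2) = 1 := by
    rw [← mul_div_assoc, Real.mul_self_sqrt (by norm_num)]; norm_num
  have hmain : Complex.exp (-(4 / 5 * N * I)) * ((1 + I) * (√(Real.pi / (N * 4)) : ℝ))
      = ((√(Real.pi / (N * 2)) * Real.sin (z + Real.pi / 4) : ℝ) : ℂ)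
        + ((√(Real.pi / (N * 2)) * Real.cos (z + Real.pi / 4) : ℝ) : ℂ) * I := by
    have e : -(4 / 5 * (N : ℂ) * I) = ((-z : ℝ) : ℂ) * I := by rw [hz]; push_cast; ring
    have h2' : (√2 : ℂ) * (√2 / 2) = 1 := by exact_mod_cast h2
    rw [e, Complex.exp_mul_I, ← Complex.ofReal_cos, ← Complex.ofReal_sin, Real.cos_neg,
      Real.sin_neg, hσ, Real.sin_add, Real.cos_add, Real.cos_pi_div_four, Real.sin_pi_div_four]
    push_cast
    linear_combination (-(√(Real.pi / (N * 4)) : ℂ)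
        * ((Complex.sin z + Complex.cos z) + (Complex.cos z - Complex.sin z) * I)) * h2'
      - (√(Real.pi / (N * 4)) : ℂ) * Complex.sin z * Complex.I_sq
  rw [hmain] at hX
  refine ⟨X, Y.re, ?_, ?_, ?_, ?_, ?_⟩
  · rw [eX]; push_cast; rfl
  · rw [eY, ← Complex.ofReal_pow, Complex.re_ofReal_mul]
  · have h := (Complex.abs_re_le_norm _).trans (hX.trans (by gcongr : A k / N ≤ C / N))
    simpa only [Complex.sub_re, Complex.add_re, Complex.ofReal_re, Complex.re_ofReal_mul,
      Complex.I_re, mul_zero, add_zero] using h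
  · have h := (Complex.abs_im_le_norm _).trans (hX.trans (by gcongr : A k / N ≤ C / N))
    simpa only [Complex.sub_im, Complex.add_im, Complex.ofReal_im, Complex.im_ofReal_mul,
      Complex.I_im, mul_one, zero_add] using h
  · have h := (Complex.abs_re_le_norm _).trans
      (hY.trans (by gcongr : B k * Real.exp z / N ≤ C * Real.exp z / N))
    rw [Complex.sub_re, Complex.ofReal_re, mul_comm (Real.exp z)] at h
    exact h

lemma abs_le_of_abs_sub_le {C n σ c x : ℝ} (hC : 0 ≤ C) (hn : 1 / 2 ≤ n) (hσ0 : 0 ≤ σ)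
    (hσ : σ ≤ 2 / n) (hc : |c| ≤ 1) (hx : |x - σ * c| ≤ C / n ^ 2) : |x| ≤ (2 + 2 * C) / n := by
  have hn0 : 0 < n := by linarith
  have h1 : |σ * c| ≤ σ := by
    rw [abs_mul, abs_of_nonneg hσ0]
    exact mul_le_of_le_one_right hσ0 hc
  have h2 : C / n ^ 2 ≤ 2 * C / n := by
    rw [div_le_div_iff₀ (by positivity) hn0]
    nlinarith [mul_nonneg (mul_nonneg hC hn0.le) (by linarith : 0 ≤ n - 1 / 2)]
  have h3 : |x| ≤ |x - σ * c| + |σ * c| := by simpa using abs_add_le (x - σ * c) (σ * c)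
  rw [add_div]
  linarith

/-- The error of a product of an oscillating factor `x ≈ σ c` with a factor `y + w` whose
exponentially large part is `y ≈ σ e`, where `σ` is of the order `1/n`; the oscillating term `w` is
negligible since `n ≤ e`. -/
lemma abs_mul_sub_le {C n e σ c x y w : ℝ} (hC : 0 ≤ C) (hn : 1 / 2 ≤ n) (he : n ≤ e)
    (hσ0 : 0 ≤ σ) (hσ : σ ≤ 2 / n) (hc : |c| ≤ 1) (hx : |x - σ * c| ≤ C / n ^ 2)
    (hy : |y - σ * e| ≤ C * e / n ^ 2) (hw : |w| ≤ (2 + 2 * C) / n) :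
    |x * (y + w) - σ ^ 2 * c * e| ≤ (C * (2 + 2 * C) + 2 * C + (2 + 2 * C) ^ 2) * (e / n ^ 3) := by
  have hn0 : 0 < n := by linarith
  have he0 : 0 < e := by linarith
  have hx' := abs_le_of_abs_sub_le hC hn hσ0 hσ hc hx
  have hy' : |y / e| ≤ (2 + 2 * C) / n := by
    refine abs_le_of_abs_sub_le (c := 1) hC hn hσ0 hσ (by simp) ?_
    have : y / e - σ * 1 = (y - σ * e) / e := by field_simp
    rw [this, abs_div, abs_of_pos he0, div_le_iff₀ he0]
    exact hy.trans_eq (by ring)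
  rw [abs_div, abs_of_pos he0, div_le_iff₀ he0] at hy'
  have e1 : x * (y + w) - σ ^ 2 * c * e = (x - σ * c) * y + σ * c * (y - σ * e) + x * w := by ring
  have b1 : |(x - σ * c) * y| ≤ C * (2 + 2 * C) * (e / n ^ 3) := by
    rw [abs_mul]
    calc _ ≤ C / n ^ 2 * ((2 + 2 * C) / n * e) := by gcongr
      _ = _ := by field_simp
  have b2 : |σ * c * (y - σ * e)| ≤ 2 * C * (e / n ^ 3) := by
    rw [abs_mul, abs_mul, abs_of_nonneg hσ0]
    calc _ ≤ 2 / n * 1 * (C * e / n ^ 2) := by gcongr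
      _ = _ := by field_simp
  have b3 : |x * w| ≤ (2 + 2 * C) ^ 2 * (e / n ^ 3) := by
    rw [abs_mul]
    calc _ ≤ (2 + 2 * C) / n * ((2 + 2 * C) / n) := by gcongr
      _ = (2 + 2 * C) ^ 2 * (n / n ^ 3) := by field_simp
      _ ≤ _ := by gcongr
  rw [e1]
  refine (abs_add_three _ _ _).trans ?_
  linarith

/-- Both asymptotic relations at `y = -μ⁴`, with the powers of `λ = μ⁴` cleared: `n` is
`μ^(5/2)`. -/
lemma exists_Phi_bounds : ∃ C : ℝ, ∀ μ n : ℝ, 0 < μ → 1 / 2 ≤ n → n ^ 2 = μ ^ 5 →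
    |Phi1 (-μ ^ 4) - 1 / Real.pi * (μ ^ 4 / μ ^ 5) * Real.exp (4 / 5 * μ ^ 5)
        * Real.sin (4 / 5 * μ ^ 5 + Real.pi / 4)|
      ≤ C * (μ ^ 4 * (Real.exp (4 / 5 * μ ^ 5) / n ^ 3)) ∧
    |Phi2 (-μ ^ 4) - 1 / Real.pi * (μ ^ 6 / μ ^ 5) * Real.exp (4 / 5 * μ ^ 5)
        * Real.cos (4 / 5 * μ ^ 5 + Real.pi / 4)|
      ≤ C * (μ ^ 6 * (Real.exp (4 / 5 * μ ^ 5) / n ^ 3)) := by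
  obtain ⟨C, hC, h⟩ := exists_moment_asymptotics
  set D := C * (2 + 2 * C) + 2 * C + (2 + 2 * C) ^ 2
  refine ⟨1 / Real.pi ^ 2 * (2 * D), fun μ n hμ hn hnN => ?_⟩
  have hn0 : 0 < n := by linarith
  have hN : 1 / 4 ≤ μ ^ 5 := by rw [← hnN]; nlinarith
  have hN0 : 0 < μ ^ 5 := by positivity
  obtain ⟨X0, Y0, eX0, eY0, r0, i0, y0⟩ := h 0 (by norm_num) μ hμ hN
  obtain ⟨X1, Y1, eX1, eY1, r1, i1, y1⟩ := h 1 (by norm_num) μ hμ hN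
  obtain ⟨X2, Y2, eX2, eY2, r2, i2, y2⟩ := h 2 (by norm_num) μ hμ hN
  obtain ⟨X3, Y3, eX3, eY3, r3, i3, y3⟩ := h 3 (by norm_num) μ hμ hN
  rw [Phi1_eq, Phi2_eq, eX0, eX1, eX2, eX3, eY0, eY1, eY2, eY3]
  simp only [Complex.re_ofReal_mul, Complex.im_ofReal_mul]
  set N := μ ^ 5
  set σ := √(Real.pi / (N * 2)) with hσdef
  set e := Real.exp (4 / 5 * N)
  set c := Real.sin (4 / 5 * N + Real.pi / 4)
  set d := Real.cos (4 / 5 * N + Real.pi / 4)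
  have hσ0 : 0 ≤ σ := Real.sqrt_nonneg _
  have hσ2 : σ ^ 2 = Real.pi / (N * 2) := Real.sq_sqrt (by positivity)
  have hσ : σ ≤ 2 / n := by
    refine Real.sqrt_le_iff.2 ⟨by positivity, ?_⟩
    rw [div_pow, hnN, div_le_div_iff₀ (by positivity) hN0]
    nlinarith [Real.pi_le_four]
  have he : n ≤ e := by
    have := Real.add_one_le_exp (4 / 5 * N)
    rw [← hnN] at this
    have h2 : 4 / 5 * n ^ 2 + 1 ≤ e := by rwa [hnN] at this ⊢
    nlinarith [sq_nonneg (n - 1)]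
  have hc : |c| ≤ 1 := Real.abs_sin_le_one _
  have hd : |d| ≤ 1 := Real.abs_cos_le_one _
  rw [← hnN] at r0 r1 r2 r3 i0 i1 i2 i3 y0 y1 y2 y3
  have bound {x : ℝ} {a : ℝ} (ha : |a| ≤ 1) (hx : |x - σ * a| ≤ C / n ^ 2) :
      |x| ≤ (2 + 2 * C) / n := abs_le_of_abs_sub_le hC hn hσ0 hσ ha hx
  have a1 := abs_mul_sub_le hC hn he hσ0 hσ hc r0 y2 (bound hd i2)
  have a2 := abs_mul_sub_le (w := -X0.im) hC hn he hσ0 hσ hc r2 y0 (by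
    rw [abs_neg]; exact bound hd i0)
  have a3 := abs_mul_sub_le (w := -X3.re) hC hn he hσ0 hσ hd i1 y3 (by
    rw [abs_neg]; exact bound hc r3)
  have a4 := abs_mul_sub_le hC hn he hσ0 hσ hd i3 y1 (bound hc r1)
  have hπ : 0 < Real.pi := Real.pi_pos
  -- The two products have the same leading term, and `2 σ² = π / N`.
  have combine (m : ℕ) (p q a : ℝ) (hp : |p - σ ^ 2 * a * e| ≤ D * (e / n ^ 3))
      (hq : |q - σ ^ 2 * a * e| ≤ D * (e / n ^ 3)) :
      |1 / Real.pi ^ 2 * (μ ^ m * (p + q)) - 1 / Real.pi * (μ ^ m / N) * e * a|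
        ≤ 1 / Real.pi ^ 2 * (2 * D) * (μ ^ m * (e / n ^ 3)) := by
    have e1 : 1 / Real.pi ^ 2 * (μ ^ m * (p + q)) - 1 / Real.pi * (μ ^ m / N) * e * a
        = 1 / Real.pi ^ 2 * μ ^ m * ((p - σ ^ 2 * a * e) + (q - σ ^ 2 * a * e)) := by
      rw [hσ2]; field_simp; ring
    rw [e1, abs_mul, abs_of_nonneg (by positivity)]
    calc _ ≤ 1 / Real.pi ^ 2 * μ ^ m * (D * (e / n ^ 3) + D * (e / n ^ 3)) := by
          gcongr
          exact (abs_add_le _ _).trans (add_le_add hp hq)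
      _ = _ := by ring
  constructor
  · convert! combine 4 _ _ c a1 a2 using 3
    ring
  · convert! combine 6 _ _ d a3 a4 using 3
    ring

/-- The improper integrals converge and the derivatives in `Phi1` and `Phi2` exist (first four
conjuncts), and both asymptotic relations hold uniformly on `(lam0, ∞)`. -/
theorem corollary3p1 :
    (∀ y : ℝ, Tendsto (fun R : ℝ => 1 / Real.pi * ∫ t in (0 : ℝ)..R, airyFourIntegrand y t)
      atTop (𝓝 (airyFour y))) ∧
    (∀ y : ℝ, Tendsto (fun R : ℝ => 1 / Real.pi * ∫ t in (0 : ℝ)..R, airyFourTildeIntegrand y t)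
      atTop (𝓝 (airyFourTilde y))) ∧
    ContDiff ℝ 3 airyFour ∧
    ContDiff ℝ 3 airyFourTilde ∧
    ∃ lam0 : ℝ, 0 < lam0 ∧ lam0 ≤ 1 / 2 ∧
      (∃ C : ℝ, ∀ lam : ℝ, lam0 < lam →
        |Phi1 (-lam) -
            1 / Real.pi * lam ^ (-(1 / 4) : ℝ) * Real.exp (4 / 5 * lam ^ (5 / 4 : ℝ)) *
              Real.sin (4 / 5 * lam ^ (5 / 4 : ℝ) + Real.pi / 4)|
          ≤ C * (Real.exp (4 / 5 * lam ^ (5 / 4 : ℝ)) / lam ^ (7 / 8 : ℝ))) ∧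
      (∃ C : ℝ, ∀ lam : ℝ, lam0 < lam →
        |Phi2 (-lam) -
            1 / Real.pi * lam ^ (1 / 4 : ℝ) * Real.exp (4 / 5 * lam ^ (5 / 4 : ℝ)) *
              Real.cos (4 / 5 * lam ^ (5 / 4 : ℝ) + Real.pi / 4)|
          ≤ C * (Real.exp (4 / 5 * lam ^ (5 / 4 : ℝ)) / lam ^ (3 / 8 : ℝ))) := by
  refine ⟨fun y => ?_, fun y => ?_, contDiff_airyFour, contDiff_airyFourTilde, 1 / 2,
    by norm_num, le_rfl, ?_⟩
  · rw [airyFour_eq]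
    exact (tendsto_integral_airyFourIntegrand y).const_mul _
  · rw [airyFourTilde_eq]
    exact (tendsto_integral_airyFourTildeIntegrand y).const_mul _
  obtain ⟨C, hC⟩ := exists_Phi_bounds
  -- The bounds are used with `μ = λ^(1/4)` and `n = λ^(5/8)`.
  have hpow {lam : ℝ} (h0 : 0 < lam) (a : ℝ) (m : ℕ) : (lam ^ a) ^ m = lam ^ (a * m) := by
    rw [← Real.rpow_natCast, ← Real.rpow_mul h0.le]
  have key (lam : ℝ) (hlam : 1 / 2 < lam) :=
    have h0 : 0 < lam := by linarith
    hC (lam ^ (1 / 4 : ℝ)) (lam ^ (5 / 8 : ℝ)) (by positivity)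
      (by
        calc (1 / 2 : ℝ) = (1 / 2) ^ (1 : ℝ) := (Real.rpow_one _).symm
          _ ≤ (1 / 2) ^ (5 / 8 : ℝ) :=
            Real.rpow_le_rpow_of_exponent_ge (by norm_num) (by norm_num) (by norm_num)
          _ ≤ lam ^ (5 / 8 : ℝ) := by gcongr)
      (by rw [hpow h0, hpow h0]; norm_num)
  have p4 {lam : ℝ} (h0 : 0 < lam) : (lam ^ (1 / 4 : ℝ)) ^ 4 = lam := by
    rw [hpow h0]; norm_num
  have p5 {lam : ℝ} (h0 : 0 < lam) : (lam ^ (1 / 4 : ℝ)) ^ 5 = lam ^ (5 / 4 : ℝ) := by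
    rw [hpow h0]; norm_num
  have p6 {lam : ℝ} (h0 : 0 < lam) : (lam ^ (1 / 4 : ℝ)) ^ 6 = lam ^ (3 / 2 : ℝ) := by
    rw [hpow h0]; norm_num
  have p15 {lam : ℝ} (h0 : 0 < lam) : (lam ^ (5 / 8 : ℝ)) ^ 3 = lam ^ (15 / 8 : ℝ) := by
    rw [hpow h0]; norm_num
  have hdiv {lam a b c : ℝ} (h0 : 0 < lam) (h : a = b + c) : lam ^ a / lam ^ b = lam ^ c := by
    rw [← Real.rpow_sub h0, h, add_sub_cancel_left]
  refine ⟨⟨C, fun lam hlam => ?_⟩, ⟨C, fun lam hlam => ?_⟩⟩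
  · have h0 : 0 < lam := by linarith
    have h := (key lam hlam).1
    have d1 : lam / lam ^ (5 / 4 : ℝ) = lam ^ (-(1 / 4) : ℝ) := by
      conv_lhs => rw [← Real.rpow_one lam, ← Real.rpow_mul h0.le, one_mul]
      exact hdiv h0 (by norm_num)
    have d2 : lam ^ (15 / 8 : ℝ) = lam * lam ^ (7 / 8 : ℝ) := by
      rw [← Real.rpow_one_add' h0.le (by norm_num)]; norm_num
    rw [p4 h0, p5 h0, p15 h0, d1, d2] at h
    refine h.trans_eq ?_
    field_simp
  · have h0 : 0 < lam := by linarith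
    have h := (key lam hlam).2
    have d2 : lam ^ (15 / 8 : ℝ) = lam ^ (3 / 2 : ℝ) * lam ^ (3 / 8 : ℝ) := by
      rw [← Real.rpow_add h0]; norm_num
    rw [p4 h0, p5 h0, p6 h0, p15 h0, hdiv h0 (c := 1 / 4) (by norm_num), d2] at h
    refine h.trans_eq ?_
    field_simp

end
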